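/- Let $n\ge m\ge 2$ be integers, and let $Z_1,\dots,Z_n$ be jointly multivariate normal random variables with $\mathbb{E}Z_i=0$ and $\mathbb{E}Z_i^2=1$ for all $i$. Write $r_{i,j}=\mathbb{E}Z_iZ_j$, and suppose that $|r_{i,j}|<1$ whenever $i\ne j$. Let $V_1,\dots,V_{m-1}$ be jointly multivariate normal random variables with mean zero, variance one and correlations $$\mathbb{E}V_jV_k=\frac{r_{j,k}-r_{j,m}r_{k,m}}{\sqrt{(1-r_{j,m}^2)(1-r_{k,m}^2)}}\qquad(1\le j,k\le m-1),$$ and for real $u,h$ put $$P(m,h)=\mathbb{P}\left(V_j\le\frac{u-r_{j,m}(u+h)}{\sqrt{1-r_{j,m}^2}}\ \text{ for all } 1\le j\le m-1\right).$$ Let $u\ge 0$, and let $h$ be a real number such that $\frac{u-r_{j,m}(u+h)}{\sqrt{1-r_{j,m}^2}}\ge 0$ for all $1\le j\le m-1$. Suppose that there are numbers $c_1,\dots,c_{m-1},d_1,\dots,d_{m-1}>0$ (which may depend on $m$ and $h$) such that (i) $c_j/d_j$ is a non-decreasing sequence, $1\le j\le m-1$; (ii) $c_{\min\{j,k\}}\,d_{\max\{j,k\}}<r_{j,k}-r_{j,m}r_{k,m}$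 for all $1\le j,k\le m-1$ (including $j=k$). Then for every $\delta\ge 0$, $$P(m,h)\ \ge\ \int_{-B(\delta)}^{B(\delta)}\frac{e^{-t^2/2}}{\sqrt{2\pi}}\,dt\cdot\prod_{j=1}^{m-1}\Phi\left(\frac{(1-\delta)\,(u-r_{j,m}(u+h))}{\sqrt{1-r_{j,m}^2-c_jd_j}}\right),$$ where $$B(\delta)=\delta\sqrt{\frac{d_{m-1}}{c_{m-1}}}\ \min_{1\le j\le m-1}\frac{u-r_{j,m}(u+h)}{d_j}$$ and $\Phi$ denotes the standard normal cumulative distribution function. -/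

import Mathlib

open MeasureTheory ProbabilityTheory

/-- The random variables `X 1, …, X n` are jointly (multivariate) normal, possibly with a singular
covariance matrix, centralised, normalised, and have correlations `ρ i j = E (X i) (X j)`. -/
structure IsStdGaussianFamily {Ω : Type*} [MeasurableSpace Ω] (μ : Measure Ω) (n : ℕ)
    (X : ℕ → Ω → ℝ) (ρ : ℕ → ℕ → ℝ) : Prop where
  gaussian : HasGaussianLaw (fun ω => fun i : Finset.Icc 1 n => X i ω) μ
  mean_zero : ∀ i ∈ Finset.Icc 1 n, ∫ ω, X i ω ∂μ = 0
  variance_one : ∀ i ∈ Finset.Icc 1 n, ∫ ω, X i ω ^ 2 ∂μ = 1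
  correlation : ∀ i ∈ Finset.Icc 1 n, ∀ j ∈ Finset.Icc 1 n, ∫ ω, X i ω * X j ω ∂μ = ρ i j

/-- The correlations `(r_{j,k} - r_{j,m} r_{k,m}) / √((1 - r_{j,m}²)(1 - r_{k,m}²))`
of the variables `V_{j,m}`. -/
noncomputable def residualCorr (r : ℕ → ℕ → ℝ) (m j k : ℕ) : ℝ :=
  (r j k - r j m * r k m) / √((1 - r j m ^ 2) * (1 - r k m ^ 2))

/-- The upper bound `(u - r_{j,m} (u + h)) / √(1 - r_{j,m}²)` imposed on `V_{j,m}`. -/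
noncomputable def upperBound (r : ℕ → ℕ → ℝ) (u h : ℝ) (m j : ℕ) : ℝ :=
  (u - r j m * (u + h)) / √(1 - r j m ^ 2)

/-- `P(m,h)`: the probability that `V j` is at most its upper bound for all `1 ≤ j ≤ m - 1`. -/
noncomputable def jointProb {Ω : Type*} [MeasurableSpace Ω] (ν : Measure Ω) (V : ℕ → Ω → ℝ)
    (r : ℕ → ℕ → ℝ) (u : ℝ) (m : ℕ) (h : ℝ) : ℝ :=
  ν.real {ω | ∀ j ∈ Finset.Icc 1 (m - 1), V j ω ≤ upperBound r u h m j}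

/-- `B(δ) = δ √(d_{m-1} / c_{m-1}) min_{1 ≤ j ≤ m-1} (u - r_{j,m} (u + h)) / d_j`,
for `m ≥ 2`. -/
noncomputable def boundB (r : ℕ → ℕ → ℝ) (c d : ℕ → ℝ) (u h : ℝ) (m : ℕ) (hm : 2 ≤ m)
    (δ : ℝ) : ℝ :=
  δ * √(d (m - 1) / c (m - 1)) *
    (Finset.Icc 1 (m - 1)).inf' (Finset.nonempty_Icc.2 (by omega))
      (fun j => (u - r j m * (u + h)) / d j)

/-- The standard normal cumulative distribution function. -/
noncomputable def stdNormalCDF (x : ℝ) : ℝ := cdf (gaussianReal 0 1) x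

open Filter Topology

/-! Multiply each `V j` by `√(1 - r_{j,m}²)`: the event becomes `X j ≤ a j`, with `a j = u -
r_{j,m}(u + h)` and covariances `r_{j,k} - r_{j,m} r_{k,m}`. The vector `X` is compared with `Y j =
d j * S j + s j * η j`, where `S` is a Gaussian random walk (Brownian motion at the times `c j / d
j`, nondecreasing by (i)) and the `η j` are independent standard normals. For `j ≠ k` the covariance
of `Y` is `c_{min} d_{max}`, which (ii) bounds by that of `X`; `s j` is chosen so that the variances
agree. Slepian's inequality (`measureReal_forall_le_of_covariance_le`) then bounds the probability
for `X` below by the one for `Y`.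

For `Y`, split each level as `δ a j + (1 - δ) a j`. The walk pays for the first share once `S j ≤ δ
min_k (a k / d k)` for all `j`; by Lévy's maximal inequality this has probability at least that of
`|S_{m-1}|` staying below the same level, which is the Gaussian integral over `[-B(δ), B(δ)]`. The
independent `η j` pay for the second share and give the product of values of `Φ`.

Slepian's inequality is proved by interpolating between the two Gaussian vectors, differentiating by
Gaussian integration by parts, and approximating indicators by smooth steps. Lévy's inequality is
proved by induction on the number of steps. -/

/-! ### Gaussian integration by parts. -/

/-- **Stein's identity** for a centred real Gaussian measure. -/
lemma integral_mul_gaussianReal_zero (v : NNReal) {g g' : ℝ → ℝ} {C : ℝ}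
    (hg : ∀ x, HasDerivAt g (g' x) x) (hgC : ∀ x, |g x| ≤ C) (hg'C : ∀ x, |g' x| ≤ C) :
    ∫ x, x * g x ∂gaussianReal 0 v = v * ∫ x, g' x ∂gaussianReal 0 v := by
  rcases eq_or_ne v 0 with rfl | hv
  · simp
  have hv0 : (v : ℝ) ≠ 0 := by exact_mod_cast hv
  have hgd : Differentiable ℝ g := fun x => (hg x).differentiableAt
  have hg'm : Measurable g' := by
    have : g' = deriv g := funext fun x => (hg x).deriv.symm
    rw [this]; exact measurable_deriv g
  -- The density `p` satisfies `p' = -(x / v) p`, so `x g p = -v g p'` and integration by parts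
  -- moves the derivative onto `g`.
  have hpdf : ∀ x, HasDerivAt (gaussianPDFReal 0 v)
      (-(x / v) * gaussianPDFReal 0 v x) x := by
    intro x
    have h1 : HasDerivAt (fun x : ℝ => -(x - 0) ^ 2 / (2 * v)) (-(x / v)) x := by
      have := (((hasDerivAt_id x).sub_const 0).pow 2).neg.div_const (2 * (v : ℝ))
      refine this.congr_deriv ?_
      simp; field_simp
    have h2 := (h1.exp).const_mul ((√(2 * Real.pi * v))⁻¹)
    refine h2.congr_deriv ?_
    simp [gaussianPDFReal]; ring
  have hid : Integrable (fun x : ℝ => x) (gaussianReal 0 v) :=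
    (memLp_id_gaussianReal' 1 (by simp)).integrable le_rfl
  have hxint : Integrable (fun x => gaussianPDFReal 0 v x * x) := by
    rw [gaussianReal_of_var_ne_zero _ hv, integrable_withDensity_iff_integrable_smul'
      (measurable_gaussianPDF _ _) (ae_of_all _ fun _ => gaussianPDF_lt_top)] at hid
    simpa [toReal_gaussianPDF] using hid
  rw [integral_gaussianReal_eq_integral_smul hv, integral_gaussianReal_eq_integral_smul hv]
  have hpi := integrable_gaussianPDFReal 0 v
  have key := integral_bilinear_hasDerivAt_right_eq_neg_left_of_integrable
    (L := ContinuousLinearMap.mul ℝ ℝ) (u := g) (u' := g') (v := gaussianPDFReal 0 v)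
    (v' := fun x => -(x / v) * gaussianPDFReal 0 v x) (fun x _ => hg x) (fun x _ => hpdf x)
    (by
      have := (hxint.bdd_mul (c := C) hgd.continuous.aestronglyMeasurable
        (ae_of_all _ fun x => by simpa using hgC x)).const_mul (-(1 / (v : ℝ)))
      refine this.congr (ae_of_all _ fun x => ?_)
      simp; ring)
    (hpi.bdd_mul (c := C) hg'm.aestronglyMeasurable
      (ae_of_all _ fun x => by simpa using hg'C x))
    (hpi.bdd_mul (c := C) hgd.continuous.aestronglyMeasurable
      (ae_of_all _ fun x => by simpa using hgC x))
  simp only [ContinuousLinearMap.mul_apply'] at key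
  have e1 : ∫ x, g x * (-(x / v) * gaussianPDFReal 0 v x)
      = -(1 / (v : ℝ)) * ∫ x, gaussianPDFReal 0 v x • (x * g x) := by
    rw [← integral_const_mul]; congr 1; ext x; simp; ring
  have e2 : ∫ x, g' x * gaussianPDFReal 0 v x = ∫ x, gaussianPDFReal 0 v x • g' x := by
    congr 1; ext x; simp [mul_comm]
  rw [e1, e2] at key
  field_simp at key
  linarith

/-- **Gaussian integration by parts**: if `(W, Z)` is jointly Gaussian with `W` centred, then
`E[W g(Z)] = ∑ j, Cov(W, Z j) E[∂ⱼ g(Z)]`. -/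
lemma ProbabilityTheory.HasGaussianLaw.integral_mul_comp_eq {Ω ι : Type*} [MeasurableSpace Ω]
    [Fintype ι] {P : Measure Ω} {W : Ω → ℝ} {Z : Ω → ι → ℝ}
    (hWZ : HasGaussianLaw (fun ω => (W ω, Z ω)) P) (hW : ∫ ω, W ω ∂P = 0)
    {g : (ι → ℝ) → ℝ} {g' : ι → (ι → ℝ) → ℝ} {C : ℝ}
    (hg : ∀ z, HasFDerivAt g (∑ j, g' j z • (ContinuousLinearMap.proj j : (ι → ℝ) →L[ℝ] ℝ)) z)
    (hg'c : ∀ j, Continuous (g' j)) (hgC : ∀ z, |g z| ≤ C) (hg'C : ∀ j z, |g' j z| ≤ C) :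
    ∫ ω, W ω * g (Z ω) ∂P = ∑ j, cov[W, fun ω => Z ω j; P] * ∫ ω, g' j (Z ω) ∂P := by
  have := hWZ.isProbabilityMeasure
  have hWG : HasGaussianLaw W P := hWZ.fst
  have hZG : HasGaussianLaw Z P := hWZ.snd
  have hZj : ∀ j, HasGaussianLaw (fun ω => Z ω j) P := fun j => hZG.eval j
  have hgcont : Continuous g := (show Differentiable ℝ g from
    fun z => (hg z).differentiableAt).continuous
  have hW2 := hWG.memLp_two
  -- The degenerate case is separate because the regression coefficients below divide by the
  -- variance.
  by_cases hv : Var[W; P] = 0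
  · have hW0 : W =ᵐ[P] 0 := by
      have : eVar[W; P] = 0 := by rw [← ofReal_variance hW2, hv, ENNReal.ofReal_zero]
      rw [evariance_eq_zero_iff hWG.aemeasurable] at this
      filter_upwards [this] with ω h
      simpa [hW] using h
    have h0 : ∀ j, cov[W, fun ω => Z ω j; P] = 0 := by
      intro j
      rw [covariance, hW]
      refine integral_eq_zero_of_ae ?_
      filter_upwards [hW0] with ω h
      simp [h]
    simp only [h0, zero_mul, Finset.sum_const_zero]
    refine integral_eq_zero_of_ae ?_
    filter_upwards [hW0] with ω h
    simp [h]
  set v := Var[W; P] with hvdef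
  have hvpos : 0 < v := lt_of_le_of_ne (variance_nonneg _ _) (Ne.symm hv)
  -- Regression of `Z` on `W`: the residual `Z'` is uncorrelated with `W`, hence independent of it
  -- by joint normality. With `Z'` frozen, the one-dimensional identity applies to `w ↦ g (z + w •
  -- b)`.
  set b : ι → ℝ := fun j => cov[W, fun ω => Z ω j; P] / v with hb
  set Z' : Ω → ι → ℝ := fun ω => Z ω - W ω • b with hZ'
  let L : ℝ × (ι → ℝ) →L[ℝ] ℝ × (ι → ℝ) :=
    (ContinuousLinearMap.fst ℝ ℝ (ι → ℝ)).prod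
      (ContinuousLinearMap.snd ℝ ℝ (ι → ℝ) -
        (ContinuousLinearMap.fst ℝ ℝ (ι → ℝ)).smulRight b)
  have hWZ' : HasGaussianLaw (fun ω => (W ω, Z' ω)) P := hWZ.map_fun L
  have hind : IndepFun W Z' P := by
    let L' : ℝ × (ι → ℝ) →L[ℝ] (Unit → ℝ) × (ι → ℝ) :=
      (ContinuousLinearMap.pi fun _ => ContinuousLinearMap.fst ℝ ℝ (ι → ℝ)).prod
        (ContinuousLinearMap.snd ℝ ℝ (ι → ℝ))
    have h1 : HasGaussianLaw (fun ω => ((fun _ : Unit => W ω), fun j => Z' ω j)) P :=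
      hWZ'.map_fun L'
    have h2 := HasGaussianLaw.indepFun_of_covariance_eval (X := fun _ : Unit => W)
      (Y := fun j ω => Z' ω j) h1 (by
        intro _ j
        have : (fun ω => Z' ω j) = (fun ω => Z ω j) - fun ω => W ω * b j := by
          ext ω; simp [hZ']
        rw [this, covariance_sub_right hW2 (hZj j).memLp_two (hW2.mul_const _),
          covariance_mul_const_right, covariance_self hWG.aemeasurable]
        simp only [hb]
        field_simp
        simp [hvdef])
    exact h2.comp (φ := fun f : Unit → ℝ => f ()) (ψ := id) (by fun_prop) measurable_id
  have hmap : P.map (fun ω => (W ω, Z' ω)) =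
      (gaussianReal 0 v.toNNReal).prod (P.map Z') := by
    rw [hind.map_prod_eq_prod_map_map hWG.aemeasurable hWZ'.snd.aemeasurable,
      hWG.map_eq_gaussianReal, hW]
  have hpr : IsProbabilityMeasure (P.map Z') :=
    Measure.isProbabilityMeasure_map hWZ'.snd.aemeasurable
  have hZeq : ∀ ω, Z ω = Z' ω + W ω • b := fun ω => by simp [hZ']
  have hmapint : ∀ f : ℝ × (ι → ℝ) → ℝ, Measurable f →
      ∫ ω, f (W ω, Z' ω) ∂P = ∫ p, f p ∂((gaussianReal 0 v.toNNReal).prod (P.map Z')) := by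
    intro f hf
    rw [← hmap, integral_map hWZ'.aemeasurable hf.aestronglyMeasurable]
  have hcomb : Measurable fun p : ℝ × (ι → ℝ) => p.2 + p.1 • b := by fun_prop
  have hgb : ∀ z w, HasDerivAt (fun w : ℝ => g (z + w • b)) (∑ j, b j * g' j (z + w • b)) w := by
    intro z w
    have h1 : HasDerivAt (fun w : ℝ => z + w • b) b w := by
      simpa using ((hasDerivAt_id w).smul_const b).const_add z
    have := (hg (z + w • b)).comp_hasDerivAt w h1
    refine this.congr_deriv ?_
    simp [mul_comm]
  have hbound : ∀ z : ι → ℝ, |∑ j, b j * g' j z| ≤ ∑ j, |b j| * C := fun z =>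
    (Finset.abs_sum_le_sum_abs _ _).trans (Finset.sum_le_sum fun j _ => by
      rw [abs_mul]; exact mul_le_mul_of_nonneg_left (hg'C j z) (abs_nonneg _))
  have hidint : Integrable (fun x : ℝ => x) (gaussianReal 0 v.toNNReal) :=
    (memLp_id_gaussianReal' 1 (by simp)).integrable le_rfl
  calc ∫ ω, W ω * g (Z ω) ∂P
      = ∫ p, p.1 * g (p.2 + p.1 • b) ∂((gaussianReal 0 v.toNNReal).prod (P.map Z')) := by
        rw [← hmapint _ (by fun_prop)]
        simp only [hZeq]
    _ = ∫ z, ∫ w, w * g (z + w • b) ∂(gaussianReal 0 v.toNNReal) ∂(P.map Z') := by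
        rw [integral_prod_symm]
        have h1 := hidint.comp_fst (P.map Z')
        exact h1.mul_bdd (c := C)
          (hgcont.measurable.comp hcomb).aestronglyMeasurable
          (ae_of_all _ fun p => by simpa using hgC _)
    _ = ∫ z, ∫ w, v * ∑ j, b j * g' j (z + w • b) ∂(gaussianReal 0 v.toNNReal) ∂(P.map Z') := by
        congr 1; ext z
        rw [integral_mul_gaussianReal_zero v.toNNReal (C := max C (∑ j, |b j| * C)) (hgb z)
          (fun x => (hgC _).trans (le_max_left _ _))
          (fun x => (hbound _).trans (le_max_right _ _)), integral_const_mul,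
          Real.coe_toNNReal _ hvpos.le]
    _ = ∫ ω, v * ∑ j, b j * g' j (Z ω) ∂P := by
        have hm : Measurable fun p : ℝ × (ι → ℝ) => v * ∑ j, b j * g' j (p.2 + p.1 • b) := by
          have := fun j => (hg'c j).measurable.comp hcomb
          simp only [Function.comp_def] at this
          fun_prop
        rw [← integral_prod_symm (fun p : ℝ × (ι → ℝ) => v * ∑ j, b j * g' j (p.2 + p.1 • b)),
          ← hmapint _ hm]
        · simp only [hZeq]
        · refine Integrable.of_bound hm.aestronglyMeasurable (v * ∑ j, |b j| * C)
            (ae_of_all _ fun p => ?_)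
          rw [Real.norm_eq_abs, abs_mul, abs_of_pos hvpos]
          exact mul_le_mul_of_nonneg_left (hbound _) hvpos.le
    _ = ∑ j, cov[W, fun ω => Z ω j; P] * ∫ ω, g' j (Z ω) ∂P := by
        simp only [Finset.mul_sum]
        rw [integral_finsetSum]
        · refine Finset.sum_congr rfl fun j _ => ?_
          rw [← integral_const_mul]
          congr 1; ext ω
          simp only [hb]; field_simp
        · intro j _
          refine (Integrable.const_mul ?_ _).const_mul _
          exact Integrable.of_bound
            ((hg'c j).measurable.comp_aemeasurable hZG.aemeasurable).aestronglyMeasurable C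
            (ae_of_all _ fun ω => by simpa using hg'C _ _)

/-! ### Products of one-variable functions and their partial derivatives. -/

/-- The function `z ↦ ∏ k, ψ k (z k)` of the coordinates of a vector. -/
def coordProd {ι : Type*} [Fintype ι] (ψ : ι → ℝ → ℝ) (z : ι → ℝ) : ℝ := ∏ k, ψ k (z k)

/-- The family of factors of the `j`-th partial derivative of `coordProd ψ`. -/
noncomputable def derivFactor {ι : Type*} [DecidableEq ι] (ψ : ι → ℝ → ℝ) (j : ι) : ι → ℝ → ℝ :=
  Function.update ψ j (deriv (ψ j))

lemma hasFDerivAt_coordProd {ι : Type*} [Fintype ι] [DecidableEq ι]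
    {ψ : ι → ℝ → ℝ} (hψ : ∀ k, Differentiable ℝ (ψ k)) (z : ι → ℝ) :
    HasFDerivAt (coordProd ψ)
      (∑ j, coordProd (derivFactor ψ j) z • (ContinuousLinearMap.proj j : (ι → ℝ) →L[ℝ] ℝ)) z := by
  have h1 : ∀ k ∈ (Finset.univ : Finset ι), HasFDerivAt (fun z : ι → ℝ => ψ k (z k))
      (deriv (ψ k) (z k) • (ContinuousLinearMap.proj k : (ι → ℝ) →L[ℝ] ℝ)) z := fun k _ =>
    ((hψ k) (z k)).hasDerivAt.comp_hasFDerivAt z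
      (ContinuousLinearMap.proj k : (ι → ℝ) →L[ℝ] ℝ).hasFDerivAt
  have h2 := HasFDerivAt.finsetProd h1
  refine h2.congr_fderiv (Finset.sum_congr rfl fun j _ => ?_)
  rw [smul_smul]
  congr 1
  rw [coordProd, ← Finset.mul_prod_erase _ _ (Finset.mem_univ j), mul_comm]
  congr 1
  · simp [derivFactor]
  · refine Finset.prod_congr rfl fun k hk => ?_
    simp [derivFactor, Finset.ne_of_mem_erase hk]

lemma continuous_coordProd {ι : Type*} [Fintype ι] {ψ : ι → ℝ → ℝ} (hψ : ∀ k, Continuous (ψ k)) :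
    Continuous (coordProd ψ) :=
  continuous_finsetProd _ fun k _ => (hψ k).comp (continuous_apply k)

lemma abs_coordProd_le {ι : Type*} [Fintype ι] {ψ : ι → ℝ → ℝ} {C : ℝ} (hψ : ∀ k x, |ψ k x| ≤ C)
    (z : ι → ℝ) :
    |coordProd ψ z| ≤ C ^ Fintype.card ι := by
  rw [coordProd, Finset.abs_prod]
  exact (Finset.prod_le_prod (fun _ _ => abs_nonneg _) fun k _ => hψ k (z k)).trans_eq (by simp)

/-- A family of bounded nonnegative nonincreasing `C²` functions with bounded derivatives up to
order two. -/
structure IsDecreasingTest {ι : Type*} (φ : ι → ℝ → ℝ) (C : ℝ) : Prop where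
  contDiff : ∀ k, ContDiff ℝ 2 (φ k)
  abs_le : ∀ k x, |φ k x| ≤ C
  abs_deriv_le : ∀ k x, |deriv (φ k) x| ≤ C
  abs_deriv_deriv_le : ∀ k x, |deriv (deriv (φ k)) x| ≤ C
  nonneg : ∀ k x, 0 ≤ φ k x
  deriv_nonpos : ∀ k x, deriv (φ k) x ≤ 0

namespace IsDecreasingTest

lemma contDiff_deriv {ι : Type*}
    {φ : ι → ℝ → ℝ} {C : ℝ} (h : IsDecreasingTest φ C) (k : ι) : ContDiff ℝ 1 (deriv (φ k)) := by
  have := h.contDiff k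
  rw [show (2 : WithTop ℕ∞) = 1 + 1 by norm_num, contDiff_succ_iff_deriv] at this
  exact this.2.2

lemma contDiff_derivFactor {ι : Type*} [DecidableEq ι]
    {φ : ι → ℝ → ℝ} {C : ℝ} (h : IsDecreasingTest φ C) (i k : ι) :
    ContDiff ℝ 1 (derivFactor φ i k) := by
  by_cases hk : k = i
  · subst hk; simpa [derivFactor] using h.contDiff_deriv k
  · simpa [derivFactor, hk] using (h.contDiff k).of_le (by norm_num)

lemma continuous_derivFactor_derivFactor {ι : Type*} [DecidableEq ι]
    {φ : ι → ℝ → ℝ} {C : ℝ} (h : IsDecreasingTest φ C) (i j k : ι) :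
    Continuous (derivFactor (derivFactor φ i) j k) := by
  by_cases hk : k = j
  · subst hk
    simpa [derivFactor] using (h.contDiff_derivFactor i k).continuous_deriv le_rfl
  · simpa [derivFactor, hk] using (h.contDiff_derivFactor i k).continuous

lemma abs_derivFactor_le {ι : Type*} [DecidableEq ι]
    {φ : ι → ℝ → ℝ} {C : ℝ} (h : IsDecreasingTest φ C) (i k : ι) (x : ℝ) :
    |derivFactor φ i k x| ≤ C := by
  by_cases hk : k = i
  · subst hk; simpa [derivFactor] using h.abs_deriv_le k x
  · simpa [derivFactor, hk] using h.abs_le k x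

lemma abs_derivFactor_derivFactor_le {ι : Type*} [DecidableEq ι]
    {φ : ι → ℝ → ℝ} {C : ℝ} (h : IsDecreasingTest φ C) (i j k : ι) (x : ℝ) :
    |derivFactor (derivFactor φ i) j k x| ≤ C := by
  by_cases hk : k = j
  · subst hk
    by_cases hi : k = i
    · subst hi; simpa [derivFactor] using h.abs_deriv_deriv_le k x
    · simpa [derivFactor, hi] using h.abs_deriv_le k x
  · simpa [derivFactor, hk] using h.abs_derivFactor_le i k x

/-- For distinct indices exactly two factors are first derivatives, both nonpositive, and the others
are nonnegative. For equal indices a second derivative of unknown sign would appear. -/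
lemma coordProd_derivFactor_derivFactor_nonneg {ι : Type*} [Fintype ι] [DecidableEq ι]
    {φ : ι → ℝ → ℝ} {C : ℝ} (h : IsDecreasingTest φ C) {i j : ι} (hij : i ≠ j)
    (z : ι → ℝ) : 0 ≤ coordProd (derivFactor (derivFactor φ i) j) z := by
  rw [coordProd, ← Finset.mul_prod_erase _ _ (Finset.mem_univ i),
    ← Finset.mul_prod_erase _ _ (Finset.mem_erase.2 ⟨hij.symm, Finset.mem_univ j⟩), ← mul_assoc]
  refine mul_nonneg (mul_nonneg_of_nonpos_of_nonpos ?_ ?_) (Finset.prod_nonneg fun k hk => ?_)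
  · simpa [derivFactor, hij] using h.deriv_nonpos i _
  · simpa [derivFactor, hij.symm] using h.deriv_nonpos j _
  · simp only [Finset.mem_erase, Finset.mem_univ, and_true] at hk
    simpa [derivFactor, hk.1, hk.2] using h.nonneg k _

end IsDecreasingTest

/-! ### Interpolation between two Gaussian vectors. -/

/-- The expectation of a product of nonincreasing functions of the coordinates of a Gaussian vector
increases with the correlations. -/
lemma integral_coordProd_le_of_covariance_le {Ω ι : Type*} [MeasurableSpace Ω]
    [Fintype ι] [DecidableEq ι] {P : Measure Ω}
    {X Y : Ω → ι → ℝ} (hG : HasGaussianLaw (fun ω => (X ω, Y ω)) P)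
    (hX : ∀ i, ∫ ω, X ω i ∂P = 0) (hY : ∀ i, ∫ ω, Y ω i ∂P = 0)
    (hXY : ∀ i j, cov[fun ω => X ω i, fun ω => Y ω j; P] = 0)
    (hdiag : ∀ i, cov[fun ω => Y ω i, fun ω => Y ω i; P] = cov[fun ω => X ω i, fun ω => X ω i; P])
    (hle : ∀ i j, i ≠ j →
      cov[fun ω => Y ω i, fun ω => Y ω j; P] ≤ cov[fun ω => X ω i, fun ω => X ω j; P])
    {φ : ι → ℝ → ℝ} {C : ℝ} (hφ : IsDecreasingTest φ C) :
    ∫ ω, coordProd φ (Y ω) ∂P ≤ ∫ ω, coordProd φ (X ω) ∂P := by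
  have := hG.isProbabilityMeasure
  have hXi : ∀ i, HasGaussianLaw (fun ω => X ω i) P := fun i => hG.fst.eval i
  have hYi : ∀ i, HasGaussianLaw (fun ω => Y ω i) P := fun i => hG.snd.eval i
  -- The path runs from `Y` at `θ = 0` to `X` at `θ = π / 2`, and `W` is its derivative in `θ`.
  -- Unlike an interpolation with weights `√t` and `√(1 - t)`, it is smooth at both ends.
  set Z : ℝ → Ω → ι → ℝ := fun θ ω => Real.sin θ • X ω + Real.cos θ • Y ω with hZ
  set W : ℝ → ι → Ω → ℝ := fun θ i ω => Real.cos θ * X ω i - Real.sin θ * Y ω i with hW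
  have hZm : ∀ θ, AEMeasurable (Z θ) P := fun θ =>
    (hG.map_fun (Real.sin θ • ContinuousLinearMap.fst ℝ (ι → ℝ) (ι → ℝ) +
      Real.cos θ • ContinuousLinearMap.snd ℝ (ι → ℝ) (ι → ℝ))).aemeasurable
  have hφd : ∀ k, Differentiable ℝ (φ k) := fun k => (hφ.contDiff k).differentiable (by norm_num)
  have hFc : Continuous (coordProd φ) := continuous_coordProd fun k => (hφd k).continuous
  have hGc : ∀ i, Continuous (coordProd (derivFactor φ i)) := fun i =>
    continuous_coordProd fun k => (hφ.contDiff_derivFactor i k).continuous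
  set K := C ^ Fintype.card ι with hK
  have hGC : ∀ i z, |coordProd (derivFactor φ i) z| ≤ K := fun i =>
    abs_coordProd_le (hφ.abs_derivFactor_le i)
  have hWint : ∀ θ i, Integrable (W θ i) P := fun θ i =>
    Integrable.sub ((hXi i).integrable.const_mul _) ((hYi i).integrable.const_mul _)
  have hderiv : ∀ θ, HasDerivAt (fun θ => ∫ ω, coordProd φ (Z θ ω) ∂P)
      (∫ ω, ∑ i, W θ i ω * coordProd (derivFactor φ i) (Z θ ω) ∂P) θ := by
    intro θ
    refine (hasDerivAt_integral_of_dominated_loc_of_deriv_le (μ := P) (𝕜 := ℝ) (s := Set.univ)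
      (F := fun θ ω => coordProd φ (Z θ ω))
      (F' := fun θ ω => ∑ i, W θ i ω * coordProd (derivFactor φ i) (Z θ ω))
      (bound := fun ω => ∑ i, (|X ω i| + |Y ω i|) * K) univ_mem ?_ ?_ ?_ ?_ ?_ ?_).2
    · exact Eventually.of_forall fun θ =>
        (hFc.measurable.comp_aemeasurable (hZm θ)).aestronglyMeasurable
    · exact Integrable.of_bound
        (hFc.measurable.comp_aemeasurable (hZm θ)).aestronglyMeasurable K
        (ae_of_all _ fun ω => abs_coordProd_le hφ.abs_le _)
    · exact Finset.aestronglyMeasurable_fun_sum _ fun i _ =>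
        (hWint θ i).aestronglyMeasurable.mul
          ((hGc i).measurable.comp_aemeasurable (hZm θ)).aestronglyMeasurable
    · refine ae_of_all _ fun ω t _ => ?_
      rw [Real.norm_eq_abs]
      refine (Finset.abs_sum_le_sum_abs _ _).trans (Finset.sum_le_sum fun i _ => ?_)
      rw [abs_mul]
      refine mul_le_mul ?_ (hGC i _) (abs_nonneg _) (by positivity)
      refine (abs_sub _ _).trans ?_
      rw [abs_mul, abs_mul]
      exact add_le_add (mul_le_of_le_one_left (abs_nonneg _) (Real.abs_cos_le_one t))
        (mul_le_of_le_one_left (abs_nonneg _) (Real.abs_sin_le_one t))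
    · exact integrable_finsetSum _ fun i _ =>
        ((hXi i).integrable.abs.add (hYi i).integrable.abs).mul_const _
    · refine ae_of_all _ fun ω t _ => ?_
      have h1 : HasDerivAt (fun t => Z t ω) (Real.cos t • X ω + (-Real.sin t) • Y ω) t :=
        ((Real.hasDerivAt_sin t).smul_const _).add ((Real.hasDerivAt_cos t).smul_const _)
      refine ((hasFDerivAt_coordProd hφd (Z t ω)).comp_hasDerivAt t h1).congr_deriv ?_
      simp [hW]
      exact Finset.sum_congr rfl fun i _ => by ring
  have hcov : ∀ θ i j, cov[W θ i, fun ω => Z θ ω j; P] = Real.sin θ * Real.cos θ *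
      (cov[fun ω => X ω i, fun ω => X ω j; P] - cov[fun ω => Y ω i, fun ω => Y ω j; P]) := by
    intro θ i j
    have e1 : W θ i = (fun ω => Real.cos θ * X ω i) - fun ω => Real.sin θ * Y ω i := rfl
    have e2 : (fun ω => Z θ ω j) = (fun ω => Real.sin θ * X ω j) + fun ω => Real.cos θ * Y ω j :=
      rfl
    have mX := fun i (c : ℝ) => (hXi i).memLp_two.const_mul c
    have mY := fun i (c : ℝ) => (hYi i).memLp_two.const_mul c
    rw [e1, e2, covariance_sub_left (mX i _) (mY i _) ((mX j _).add (mY j _)),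
      covariance_add_right (mX i _) (mX j _) (mY j _),
      covariance_add_right (mY i _) (mX j _) (mY j _)]
    simp only [covariance_const_mul_left, covariance_const_mul_right, hXY]
    rw [covariance_comm (fun ω => Y ω i) (fun ω => X ω j), hXY]
    ring
  -- Integration by parts replaces each `W θ i` by its covariances with `Z θ`, so the derivative is
  -- a combination of second partials weighted by the covariance gaps.
  have hstein : ∀ θ, ∫ ω, ∑ i, W θ i ω * coordProd (derivFactor φ i) (Z θ ω) ∂P =
      ∑ i, ∑ j, Real.sin θ * Real.cos θ * (cov[fun ω => X ω i, fun ω => X ω j; P] -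
        cov[fun ω => Y ω i, fun ω => Y ω j; P]) *
          ∫ ω, coordProd (derivFactor (derivFactor φ i) j) (Z θ ω) ∂P := by
    intro θ
    rw [integral_finsetSum]
    · refine Finset.sum_congr rfl fun i _ => ?_
      let L : (ι → ℝ) × (ι → ℝ) →L[ℝ] ℝ × (ι → ℝ) :=
        (ContinuousLinearMap.proj i ∘L (Real.cos θ • ContinuousLinearMap.fst ℝ (ι → ℝ) (ι → ℝ) -
          Real.sin θ • ContinuousLinearMap.snd ℝ (ι → ℝ) (ι → ℝ))).prod
        (Real.sin θ • ContinuousLinearMap.fst ℝ (ι → ℝ) (ι → ℝ) +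
          Real.cos θ • ContinuousLinearMap.snd ℝ (ι → ℝ) (ι → ℝ))
      have hL : HasGaussianLaw (fun ω => (W θ i ω, Z θ ω)) P := hG.map_fun L
      rw [hL.integral_mul_comp_eq (g := coordProd (derivFactor φ i)) (C := K)
        (g' := fun j => coordProd (derivFactor (derivFactor φ i) j))]
      · exact Finset.sum_congr rfl fun j _ => by rw [hcov]
      · simp only [hW]
        rw [integral_sub ((hXi i).integrable.const_mul _) ((hYi i).integrable.const_mul _),
          integral_const_mul, integral_const_mul, hX, hY]
        simp
      · exact hasFDerivAt_coordProd fun k =>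
          (hφ.contDiff_derivFactor i k).differentiable (by norm_num)
      · exact fun j => continuous_coordProd (hφ.continuous_derivFactor_derivFactor i j)
      · exact hGC i
      · exact fun j => abs_coordProd_le (hφ.abs_derivFactor_derivFactor_le i j)
    · intro i _
      exact (hWint θ i).mul_bdd (c := K)
        ((hGc i).measurable.comp_aemeasurable (hZm θ)).aestronglyMeasurable
        (ae_of_all _ fun ω => by simpa using hGC i _)
  have hmono : MonotoneOn (fun θ => ∫ ω, coordProd φ (Z θ ω) ∂P) (Set.Icc 0 (Real.pi / 2)) := by
    refine monotoneOn_of_deriv_nonneg (convex_Icc _ _)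
      (fun θ _ => (hderiv θ).continuousAt.continuousWithinAt)
      (fun θ _ => (hderiv θ).differentiableAt.differentiableWithinAt) fun θ hθ => ?_
    rw [interior_Icc] at hθ
    rw [(hderiv θ).deriv, hstein]
    refine Finset.sum_nonneg fun i _ => Finset.sum_nonneg fun j _ => ?_
    by_cases hij : i = j
    -- Equal variances remove exactly the diagonal terms, whose second derivatives have no definite
    -- sign.
    · subst hij; simp [hdiag]
    · exact mul_nonneg (mul_nonneg (mul_nonneg
        (Real.sin_nonneg_of_mem_Icc ⟨hθ.1.le, by linarith [hθ.2, Real.pi_pos]⟩)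
        (Real.cos_nonneg_of_mem_Icc ⟨by linarith [hθ.1, Real.pi_pos], hθ.2.le⟩))
        (sub_nonneg.2 (hle i j hij)))
        (integral_nonneg fun ω => hφ.coordProd_derivFactor_derivFactor_nonneg hij _)
  have h := hmono ⟨le_rfl, by positivity⟩ ⟨by positivity, le_rfl⟩
    (by positivity : (0 : ℝ) ≤ Real.pi / 2)
  simpa [hZ] using h

/-! ### Smooth approximation of orthant indicators. -/

/-- A smooth nonincreasing function equal to `1` on `(-∞, a]` and to `0` on
`[a + 1 / (n + 1), ∞)`. -/
noncomputable def smoothStep (n : ℕ) (a x : ℝ) : ℝ := 1 - Real.smoothTransition ((n + 1) * (x - a))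

lemma contDiff_smoothStep (n : ℕ) (a : ℝ) {k : ℕ∞} : ContDiff ℝ k (smoothStep n a) :=
  contDiff_const.sub (Real.smoothTransition.contDiff.comp
    (contDiff_const.mul (contDiff_id.sub contDiff_const)))

lemma smoothStep_nonneg (n : ℕ) (a x : ℝ) : 0 ≤ smoothStep n a x :=
  sub_nonneg.2 (Real.smoothTransition.le_one _)

lemma smoothStep_le_one (n : ℕ) (a x : ℝ) : smoothStep n a x ≤ 1 :=
  sub_le_self _ (Real.smoothTransition.nonneg _)

lemma antitone_smoothStep (n : ℕ) (a : ℝ) : Antitone (smoothStep n a) := fun x y hxy => by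
  refine sub_le_sub_left (Real.smoothTransition.monotone ?_) _
  gcongr

lemma smoothStep_of_le (n : ℕ) {a x : ℝ} (h : x ≤ a) : smoothStep n a x = 1 := by
  rw [smoothStep, Real.smoothTransition.zero_of_nonpos, sub_zero]
  exact mul_nonpos_of_nonneg_of_nonpos (by positivity) (by linarith)

lemma smoothStep_of_one_le {n : ℕ} {a x : ℝ} (h : 1 ≤ (n + 1) * (x - a)) :
    smoothStep n a x = 0 := by
  rw [smoothStep, Real.smoothTransition.one_of_one_le h, sub_self]

lemma hasCompactSupport_deriv_smoothStep (n : ℕ) (a : ℝ) :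
    HasCompactSupport (deriv (smoothStep n a)) := by
  refine HasCompactSupport.intro (isCompact_Icc (a := a) (b := a + 1)) fun x hx => ?_
  rw [Set.mem_Icc, not_and_or, not_le, not_le] at hx
  rcases hx with hx | hx
  · have : smoothStep n a =ᶠ[𝓝 x] fun _ => 1 := by
      filter_upwards [Iio_mem_nhds hx] with y hy using smoothStep_of_le n (le_of_lt hy)
    rw [this.deriv_eq, deriv_const]
  · have : smoothStep n a =ᶠ[𝓝 x] fun _ => 0 := by
      filter_upwards [Ioi_mem_nhds hx] with y hy
      refine smoothStep_of_one_le ?_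
      have h1 : 1 ≤ y - a := by linarith [Set.mem_Ioi.1 hy]
      have h2 : (0 : ℝ) ≤ n := n.cast_nonneg
      nlinarith
    rw [this.deriv_eq, deriv_const]

/-- The derivatives are continuous with compact support, hence bounded. Summing the bounds over the
finite index type gives one constant for all coordinates and orders. -/
lemma exists_isDecreasingTest_smoothStep {ι : Type*} [Fintype ι] (n : ℕ) (a : ι → ℝ) :
    ∃ C, IsDecreasingTest (fun k => smoothStep n (a k)) C := by
  have h2 : ∀ k, ContDiff ℝ 2 (smoothStep n (a k)) := fun k => contDiff_smoothStep n (a k)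
  have h1 : ∀ k, ContDiff ℝ 1 (deriv (smoothStep n (a k))) := fun k => by
    have := h2 k
    rw [show (2 : WithTop ℕ∞) = 1 + 1 by norm_num, contDiff_succ_iff_deriv] at this
    exact this.2.2
  have hc := fun k => hasCompactSupport_deriv_smoothStep n (a k)
  choose A hA using fun k => (hc k).exists_bound_of_continuous (h1 k).continuous
  choose B hB using fun k =>
    (hc k).deriv.exists_bound_of_continuous ((h1 k).continuous_deriv le_rfl)
  have hA0 : ∀ k, 0 ≤ A k := fun k => (norm_nonneg _).trans (hA k 0)
  have hB0 : ∀ k, 0 ≤ B k := fun k => (norm_nonneg _).trans (hB k 0)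
  have hAs : 0 ≤ ∑ k, A k := Finset.sum_nonneg fun k _ => hA0 k
  have hBs : 0 ≤ ∑ k, B k := Finset.sum_nonneg fun k _ => hB0 k
  refine ⟨1 + ∑ k, A k + ∑ k, B k, h2, fun k x => ?_, fun k x => ?_, fun k x => ?_,
    fun k => smoothStep_nonneg n (a k), fun k x => (antitone_smoothStep n (a k)).deriv_nonpos⟩
  · rw [abs_of_nonneg (smoothStep_nonneg n (a k) x)]
    linarith [smoothStep_le_one n (a k) x]
  · have h3 := hA k x
    have h4 := Finset.single_le_sum (fun k _ => hA0 k) (Finset.mem_univ k)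
    rw [Real.norm_eq_abs] at h3
    linarith
  · have h3 := hB k x
    have h4 := Finset.single_le_sum (fun k _ => hB0 k) (Finset.mem_univ k)
    rw [Real.norm_eq_abs] at h3
    linarith

/-- The sequence is eventually constant: a coordinate strictly above its level makes its factor
vanish once `n ≥ 1 / (z k - a k)`. Since each step equals `1` up to and including its level, the
limit is the indicator of the closed orthant and no assumption on atoms is needed. -/
lemma tendsto_coordProd_smoothStep {ι : Type*} [Fintype ι] (a z : ι → ℝ) :
    Tendsto (fun n => coordProd (fun k => smoothStep n (a k)) z) atTop
      (𝓝 ({z : ι → ℝ | ∀ k, z k ≤ a k}.indicator 1 z)) := by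
  by_cases hz : ∀ k, z k ≤ a k
  · rw [Set.indicator_of_mem (by exact hz)]
    refine tendsto_const_nhds.congr fun n => ?_
    simp [coordProd, smoothStep_of_le n (hz _)]
  · rw [Set.indicator_of_notMem (by exact hz)]
    push Not at hz
    obtain ⟨k, hk⟩ := hz
    obtain ⟨N, hN⟩ := exists_nat_ge (1 / (z k - a k))
    refine tendsto_const_nhds.congr' ?_
    filter_upwards [eventually_ge_atTop N] with n hn
    refine (Finset.prod_eq_zero (Finset.mem_univ k) (smoothStep_of_one_le ?_)).symm
    have hpos : 0 < z k - a k := by linarith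
    rw [div_le_iff₀ hpos] at hN
    have : (N : ℝ) ≤ n := by exact_mod_cast hn
    nlinarith

lemma tendsto_integral_coordProd_smoothStep {Ω ι : Type*} [MeasurableSpace Ω] [Fintype ι]
    {P : Measure Ω} [IsProbabilityMeasure P] {X : Ω → ι → ℝ} (hX : AEMeasurable X P)
    (a : ι → ℝ) :
    Tendsto (fun n => ∫ ω, coordProd (fun k => smoothStep n (a k)) (X ω) ∂P) atTop
      (𝓝 (P.real {ω | ∀ k, X ω k ≤ a k})) := by
  have hs : MeasurableSet {z : ι → ℝ | ∀ k, z k ≤ a k} := by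
    simp only [Set.ofPred_forall]
    exact MeasurableSet.iInter fun k => measurableSet_le (measurable_pi_apply k) measurable_const
  have hlim : P.real {ω | ∀ k, X ω k ≤ a k} =
      ∫ ω, {z : ι → ℝ | ∀ k, z k ≤ a k}.indicator (1 : (ι → ℝ) → ℝ) (X ω) ∂P := by
    rw [← integral_map hX (measurable_one.indicator hs).aestronglyMeasurable,
      integral_indicator_one hs, measureReal_def, measureReal_def,
      Measure.map_apply_of_aemeasurable hX hs]
    rfl
  rw [hlim]
  refine tendsto_integral_of_dominated_convergence (fun _ => 1) (fun n => ?_)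
    (integrable_const _) (fun n => ae_of_all _ fun ω => ?_)
    (ae_of_all _ fun ω => tendsto_coordProd_smoothStep a (X ω))
  · exact ((continuous_coordProd fun k =>
      (contDiff_smoothStep n (a k) (k := 0)).continuous).measurable.comp_aemeasurable
        hX).aestronglyMeasurable
  · rw [Real.norm_eq_abs]
    simpa using abs_coordProd_le (ψ := fun k => smoothStep n (a k)) (C := 1) (fun k x => by
      rw [abs_of_nonneg (smoothStep_nonneg n (a k) x)]; exact smoothStep_le_one n (a k) x) (X ω)

/-! ### Slepian's inequality. -/

lemma covariance_comp_fst {Ω Ω' : Type*} [MeasurableSpace Ω] [MeasurableSpace Ω']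
    {P : Measure Ω} {Q : Measure Ω'} [SFinite P] [IsProbabilityMeasure Q] {f g : Ω → ℝ}
    (hf : AEStronglyMeasurable f P) (hg : AEStronglyMeasurable g P) :
    cov[fun p : Ω × Ω' => f p.1, fun p => g p.1; P.prod Q] = cov[f, g; P] := by
  have hfst : MeasurePreserving Prod.fst (P.prod Q) P := measurePreserving_fst
  have h := covariance_map_fun (μ := P.prod Q) (X := f) (Y := g) (Z := Prod.fst)
    (by rwa [hfst.map_eq]) (by rwa [hfst.map_eq]) hfst.aemeasurable
  rw [hfst.map_eq] at h
  exact h.symm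

lemma covariance_comp_snd {Ω Ω' : Type*} [MeasurableSpace Ω] [MeasurableSpace Ω']
    {P : Measure Ω} {Q : Measure Ω'} [IsProbabilityMeasure P] [SFinite Q] {f g : Ω' → ℝ}
    (hf : AEStronglyMeasurable f Q) (hg : AEStronglyMeasurable g Q) :
    cov[fun p : Ω × Ω' => f p.2, fun p => g p.2; P.prod Q] = cov[f, g; Q] := by
  have hsnd : MeasurePreserving Prod.snd (P.prod Q) Q := measurePreserving_snd
  have h := covariance_map_fun (μ := P.prod Q) (X := f) (Y := g) (Z := Prod.snd)
    (by rwa [hsnd.map_eq]) (by rwa [hsnd.map_eq]) hsnd.aemeasurable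
  rw [hsnd.map_eq] at h
  exact h.symm

/-- **Slepian's inequality.** -/
theorem measureReal_forall_le_of_covariance_le {Ω Ω' ι : Type*} [MeasurableSpace Ω]
    [MeasurableSpace Ω'] [Fintype ι] {P : Measure Ω} {Q : Measure Ω'}
    {X : Ω → ι → ℝ} {Y : Ω' → ι → ℝ} (hXG : HasGaussianLaw X P) (hYG : HasGaussianLaw Y Q)
    (hX : ∀ i, ∫ ω, X ω i ∂P = 0) (hY : ∀ i, ∫ ω, Y ω i ∂Q = 0)
    (hdiag : ∀ i, cov[fun ω => Y ω i, fun ω => Y ω i; Q] = cov[fun ω => X ω i, fun ω => X ω i; P])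
    (hle : ∀ i j, i ≠ j →
      cov[fun ω => Y ω i, fun ω => Y ω j; Q] ≤ cov[fun ω => X ω i, fun ω => X ω j; P])
    (a : ι → ℝ) :
    Q.real {ω | ∀ i, Y ω i ≤ a i} ≤ P.real {ω | ∀ i, X ω i ≤ a i} := by
  classical
  have := hXG.isProbabilityMeasure
  have := hYG.isProbabilityMeasure
  have hfst : MeasurePreserving Prod.fst (P.prod Q) P := measurePreserving_fst
  have hsnd : MeasurePreserving Prod.snd (P.prod Q) Q := measurePreserving_snd
  -- Only the separate laws of `X` and `Y` matter, so they are realised independently on the product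
  -- space; this makes the pair jointly Gaussian with zero cross-covariances.
  have hX' : HasGaussianLaw (fun p : Ω × Ω' => X p.1) (P.prod Q) := ⟨by
    have h := hXG.isGaussian_map
    rwa [← hfst.map_eq, AEMeasurable.map_map_of_aemeasurable
      (by rw [hfst.map_eq]; exact hXG.aemeasurable) hfst.aemeasurable] at h⟩
  have hY' : HasGaussianLaw (fun p : Ω × Ω' => Y p.2) (P.prod Q) := ⟨by
    have h := hYG.isGaussian_map
    rwa [← hsnd.map_eq, AEMeasurable.map_map_of_aemeasurable
      (by rw [hsnd.map_eq]; exact hYG.aemeasurable) hsnd.aemeasurable] at h⟩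
  have hind : IndepFun (fun p : Ω × Ω' => X p.1) (fun p => Y p.2) (P.prod Q) :=
    indepFun_prod₀ hXG.aemeasurable hYG.aemeasurable
  have hG := IndepFun.hasGaussianLaw hX' hY' hind
  have hXm : ∀ i, AEStronglyMeasurable (fun ω => X ω i) P := fun i =>
    (hXG.eval i).aemeasurable.aestronglyMeasurable
  have hYm : ∀ i, AEStronglyMeasurable (fun ω => Y ω i) Q := fun i =>
    (hYG.eval i).aemeasurable.aestronglyMeasurable
  have key : ∀ n : ℕ, ∫ ω, coordProd (fun k => smoothStep n (a k)) (Y ω) ∂Q ≤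
      ∫ ω, coordProd (fun k => smoothStep n (a k)) (X ω) ∂P := by
    intro n
    obtain ⟨C, hC⟩ := exists_isDecreasingTest_smoothStep n a
    have hcont : Continuous (coordProd fun k => smoothStep n (a k)) :=
      continuous_coordProd fun k => (hC.contDiff k).continuous
    have h := integral_coordProd_le_of_covariance_le hG
      (fun i => by rw [integral_fun_fst (fun ω => X ω i), hX, smul_zero])
      (fun i => by rw [integral_fun_snd (fun ω => Y ω i), hY, smul_zero])
      (fun i j => covariance_fst_snd_prod (hXG.eval i).memLp_two (hYG.eval j).memLp_two)
      (fun i => by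
        rw [covariance_comp_fst (hXm i) (hXm i), covariance_comp_snd (hYm i) (hYm i), hdiag])
      (fun i j hij => by
        rw [covariance_comp_fst (hXm i) (hXm j), covariance_comp_snd (hYm i) (hYm j)]
        exact hle i j hij) hC
    rw [integral_fun_fst (fun ω => coordProd (fun k => smoothStep n (a k)) (X ω)),
      integral_fun_snd (fun ω => coordProd (fun k => smoothStep n (a k)) (Y ω))] at h
    simpa using h
  exact le_of_tendsto_of_tendsto'
    (tendsto_integral_coordProd_smoothStep hYG.aemeasurable a)
    (tendsto_integral_coordProd_smoothStep hXG.aemeasurable a) key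

/-! ### Lévy's maximal inequality. -/

lemma measureReal_gaussianReal_zero_Iic_neg (v : NNReal) (x : ℝ) :
    (gaussianReal 0 v).real (Set.Iic (-x)) = (gaussianReal 0 v).real (Set.Ici x) := by
  have h := gaussianReal_map_neg (μ := 0) (v := v)
  rw [neg_zero] at h
  conv_lhs => rw [← h]
  rw [map_measureReal_apply measurable_neg measurableSet_Iic]
  congr 1; ext y; simp

/-- The half-lines `(-∞, x]` and `[-x, ∞)` are disjoint for `x < 0` and have equal mass by symmetry.
-/
lemma two_mul_measureReal_gaussianReal_zero_Iic_le_one (v : NNReal) {x : ℝ} (hx : x < 0) :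
    2 * (gaussianReal 0 v).real (Set.Iic x) ≤ 1 := by
  have h := measureReal_gaussianReal_zero_Iic_neg v (-x)
  rw [neg_neg] at h
  have hd : Disjoint (Set.Iic x) (Set.Ici (-x)) := by
    rw [Set.disjoint_left]; intro y hy hy'
    simp only [Set.mem_Iic, Set.mem_Ici] at hy hy'; linarith
  have := measureReal_union (μ := gaussianReal 0 v) hd measurableSet_Ici
  have h1 : (gaussianReal 0 v).real (Set.Iic x ∪ Set.Ici (-x)) ≤ 1 := measureReal_le_one
  linarith

/-- **Lévy's maximal inequality** for partial sums of independent centred Gaussian variables. -/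
lemma two_mul_gaussianReal_Iic_sub_one_le_partialSums {p : ℕ} (v : Fin p → NNReal) (x : ℝ) :
    2 * (gaussianReal 0 (∑ i, v i)).real (Set.Iic x) - 1 ≤
      (Measure.pi fun i => gaussianReal 0 (v i)).real
        {ξ | ∀ j, ∑ k ∈ Finset.Iic j, ξ k ≤ x} := by
  -- Condition on the first step `w`. The left side is affine in the distribution function of the
  -- total sum, so it is the average over `w` of the same expression for the remaining steps at
  -- level `x - w`; it suffices to compare integrands.
  induction p generalizing x with
  | zero =>
    have h : (gaussianReal 0 (∑ i, v i)).real (Set.Iic x) ≤ 1 := measureReal_le_one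
    have : {ξ : Fin 0 → ℝ | ∀ j, ∑ k ∈ Finset.Iic j, ξ k ≤ x} = Set.univ := by
      ext; simp
    rw [this, probReal_univ]
    linarith
  | succ p ih =>
    set γ := Measure.pi fun i : Fin p => gaussianReal 0 (v i.succ) with hγ
    set V := ∑ i : Fin p, v i.succ with hV
    set A : ℝ → Set (Fin p → ℝ) := fun y => {ξ | ∀ j, ∑ k ∈ Finset.Iic j, ξ k ≤ y} with hA
    have hmp := measurePreserving_piFinSuccAbove (fun i : Fin (p + 1) => gaussianReal 0 (v i)) 0
    set S : Set (ℝ × (Fin p → ℝ)) := {q | q.1 ≤ x ∧ q.2 ∈ A (x - q.1)} with hS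
    have hSm : MeasurableSet S := by
      have h : S = {q | q.1 ≤ x} ∩ ⋂ j, {q | ∑ k ∈ Finset.Iic j, q.2 k ≤ x - q.1} := by
        ext q; simp [hS, hA]
      rw [h]
      exact (measurableSet_le measurable_fst measurable_const).inter
        (MeasurableSet.iInter fun j => measurableSet_le (by fun_prop) (by fun_prop))
    have hset : {ξ : Fin (p + 1) → ℝ | ∀ j, ∑ k ∈ Finset.Iic j, ξ k ≤ x} =
        MeasurableEquiv.piFinSuccAbove (fun _ => ℝ) 0 ⁻¹' S := by
      ext ξ
      have h0 : Finset.Iic (0 : Fin (p + 1)) = {0} := by ext i; simp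
      have hs : ∀ j : Fin p, ∑ k ∈ Finset.Iic j.succ, ξ k
          = ξ 0 + ∑ k ∈ Finset.Iic j, ξ k.succ := by
        intro j
        have : Finset.Iic j.succ = insert 0 ((Finset.Iic j).map (Fin.succEmb p)) := by
          ext i
          refine Fin.cases ?_ (fun i => ?_) i
          · simp
          · simp
        rw [this, Finset.sum_insert (by simp), Finset.sum_map]
        rfl
      simp only [Set.mem_ofPred_eq, Set.mem_preimage, hS, hA, Fin.forall_fin_succ, h0, hs,
        Finset.sum_singleton]
      refine and_congr Iff.rfl (forall_congr' fun j => ?_)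
      rw [le_sub_iff_add_le, add_comm]
      rfl
    rw [hset, measureReal_def (Measure.pi _), hmp.measure_preimage hSm.nullMeasurableSet,
      ← measureReal_def, ← integral_indicator_one hSm]
    change _ ≤ ∫ q, S.indicator 1 q ∂((gaussianReal 0 (v 0)).prod γ)
    have hint : Integrable (S.indicator (1 : ℝ × (Fin p → ℝ) → ℝ))
        ((gaussianReal 0 (v 0)).prod γ) := (integrable_const (1 : ℝ)).indicator hSm
    have hconv : (gaussianReal 0 (∑ i, v i)).real (Set.Iic x) =
        ∫ w, (gaussianReal 0 V).real (Set.Iic (x - w)) ∂gaussianReal 0 (v 0) := by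
      have hm : MeasurableSet {q : ℝ × ℝ | q.1 + q.2 ≤ x} :=
        measurableSet_le (by fun_prop) measurable_const
      have h1 := gaussianReal_conv_gaussianReal (m₁ := 0) (m₂ := 0) (v₁ := v 0) (v₂ := V)
      rw [Fin.sum_univ_succ, ← hV]
      rw [add_zero] at h1
      rw [← h1, Measure.conv, map_measureReal_apply (by fun_prop) measurableSet_Iic]
      change ((gaussianReal 0 (v 0)).prod (gaussianReal 0 V)).real {q : ℝ × ℝ | q.1 + q.2 ≤ x} = _
      have hi : Integrable ({q : ℝ × ℝ | q.1 + q.2 ≤ x}.indicator (1 : ℝ × ℝ → ℝ))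
          ((gaussianReal 0 (v 0)).prod (gaussianReal 0 V)) :=
        (integrable_const (1 : ℝ)).indicator hm
      rw [← integral_indicator_one hm, integral_prod _ hi]
      congr 1; ext w
      rw [← integral_indicator_one measurableSet_Iic]
      congr 1; ext y
      simp [Set.indicator, le_sub_iff_add_le, add_comm]
    have hmeas : Measurable fun w => (gaussianReal 0 V).real (Set.Iic (x - w)) := by
      refine Antitone.measurable fun w w' h => measureReal_mono (Set.Iic_subset_Iic.2 ?_)
      linarith
    have hi : Integrable (fun w => (gaussianReal 0 V).real (Set.Iic (x - w)))
        (gaussianReal 0 (v 0)) :=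
      Integrable.of_bound hmeas.aestronglyMeasurable 1 (ae_of_all _ fun w => by
        rw [Real.norm_eq_abs, abs_of_nonneg measureReal_nonneg]; exact measureReal_le_one)
    have hlhs : 2 * (gaussianReal 0 (∑ i, v i)).real (Set.Iic x) - 1 =
        ∫ w, (2 * (gaussianReal 0 V).real (Set.Iic (x - w)) - 1) ∂gaussianReal 0 (v 0) := by
      rw [hconv, integral_sub (hi.const_mul 2) (integrable_const _), integral_const_mul]
      simp
    rw [hlhs, integral_prod _ hint]
    refine integral_mono ((hi.const_mul 2).sub (integrable_const _)) hint.integral_prod_left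
      fun w => ?_
    by_cases hw : w ≤ x
    · have : (fun ξ => S.indicator (1 : ℝ × (Fin p → ℝ) → ℝ) (w, ξ)) =
          (A (x - w)).indicator 1 := by
        ext ξ; simp [Set.indicator, hS, hw]
      have hAm : MeasurableSet (A (x - w)) := by
        simp only [hA, Set.ofPred_forall]
        exact MeasurableSet.iInter fun j => measurableSet_le (by fun_prop) (by fun_prop)
      simp only [this]
      rw [integral_indicator_one hAm]
      exact ih (fun i => v i.succ) (x - w)
    -- If the first step already exceeds `x`, the remaining level is negative and the left integrand
    -- is at most zero.
    · refine le_trans ?_ (integral_nonneg fun ξ =>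
        Set.indicator_nonneg (fun _ _ => zero_le_one) _)
      have := two_mul_measureReal_gaussianReal_zero_Iic_le_one V (x := x - w) (by linarith)
      linarith

/-- The probability that a centred Gaussian variable of variance `T` lies in `[-x, x]`. -/
lemma integral_exp_neg_sq_div_two_eq (T : NNReal) (hT : T ≠ 0) {x : ℝ} (hx : 0 ≤ x) :
    ∫ t in (-(x / √T))..(x / √T), Real.exp (-t ^ 2 / 2) / √(2 * Real.pi) =
      2 * (gaussianReal 0 T).real (Set.Iic x) - 1 := by
  have hT0 : (0 : ℝ) < T := by positivity
  have hsT : 0 < √(T : ℝ) := Real.sqrt_pos.2 hT0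
  have hscale : (gaussianReal 0 T).real (Set.Iic x) =
      (gaussianReal 0 1).real (Set.Iic (x / √T)) := by
    have h := gaussianReal_map_const_mul (μ := 0) (v := 1) (√(T : ℝ))
    have hv : NNReal.mk (√(T : ℝ) ^ 2) (sq_nonneg _) * 1 = T := by
      ext; simp
    rw [mul_zero, hv] at h
    rw [← h, map_measureReal_apply (by fun_prop) measurableSet_Iic]
    congr 1; ext y; simp [le_div_iff₀ hsT, mul_comm]
  rw [hscale]
  set y := x / √(T : ℝ) with hy
  have hy0 : 0 ≤ y := by positivity
  have hna : NullSingletonClass (gaussianReal 0 1) := nullSingletonClass_gaussianReal one_ne_zero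
  have h1 : (gaussianReal 0 1).real (Set.Ioc (-y) y) =
      ∫ t in (-y)..y, Real.exp (-t ^ 2 / 2) / √(2 * Real.pi) := by
    rw [measureReal_def, gaussianReal_apply_eq_integral _ one_ne_zero, ENNReal.toReal_ofReal
      (integral_nonneg fun _ => gaussianPDFReal_nonneg _ _ _),
      intervalIntegral.integral_of_le (by linarith)]
    congr 1; ext t; simp [gaussianPDFReal]; ring
  have h2 : (gaussianReal 0 1).real (Set.Ioc (-y) y) =
      (gaussianReal 0 1).real (Set.Iic y) - (gaussianReal 0 1).real (Set.Iic (-y)) := by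
    rw [← measureReal_sdiff (Set.Iic_subset_Iic.2 (by linarith)) measurableSet_Iic]
    congr 1; ext t; simp [and_comm]
  have h3 : (gaussianReal 0 1).real (Set.Ici y) = 1 - (gaussianReal 0 1).real (Set.Iic y) := by
    rw [← probReal_compl_eq_one_sub measurableSet_Iic, Set.compl_Iic]
    exact measureReal_congr Ioi_ae_eq_Ici.symm
  rw [← h1, h2, measureReal_gaussianReal_zero_Iic_neg, h3]
  ring

/-! ### The comparison process: a scaled Gaussian walk plus independent noise. -/

lemma hasLaw_eval_pi_gaussianReal {ι : Type*} [Fintype ι] (v : ι → NNReal) (i : ι) :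
    HasLaw (fun ξ : ι → ℝ => ξ i) (gaussianReal 0 (v i))
      (Measure.pi fun i => gaussianReal 0 (v i)) :=
  (measurePreserving_eval (fun i => gaussianReal 0 (v i)) i).hasLaw

lemma hasGaussianLaw_id_pi_gaussianReal {ι : Type*} [Fintype ι] (v : ι → NNReal) :
    HasGaussianLaw (fun ξ : ι → ℝ => ξ) (Measure.pi fun i => gaussianReal 0 (v i)) :=
  iIndepFun.hasGaussianLaw (X := fun i (ξ : ι → ℝ) => ξ i)
    (fun i => (hasLaw_eval_pi_gaussianReal v i).hasGaussianLaw)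
    (iIndepFun_pi (X := fun _ => id) fun _ => aemeasurable_id)

lemma integral_eval_pi_gaussianReal {ι : Type*} [Fintype ι] (v : ι → NNReal) (i : ι) :
    ∫ ξ : ι → ℝ, ξ i ∂(Measure.pi fun i => gaussianReal 0 (v i)) = 0 := by
  rw [(hasLaw_eval_pi_gaussianReal v i).integral_eq, integral_id_gaussianReal]

lemma covariance_eval_pi_gaussianReal {ι : Type*} [Fintype ι] [DecidableEq ι] (v : ι → NNReal)
    (i j : ι) : cov[fun ξ : ι → ℝ => ξ i, fun ξ => ξ j; Measure.pi fun i => gaussianReal 0 (v i)] =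
      if i = j then (v i : ℝ) else 0 := by
  have hG := hasGaussianLaw_id_pi_gaussianReal v
  split_ifs with h
  · subst h
    rw [covariance_self (hG.eval i).aemeasurable, (hasLaw_eval_pi_gaussianReal v i).variance_eq,
      variance_id_gaussianReal]
  · exact ((iIndepFun_pi (μ := fun i => gaussianReal 0 (v i)) (X := fun _ => id)
      fun _ => aemeasurable_id).indepFun h).covariance_eq_zero (hG.eval i).memLp_two
        (hG.eval j).memLp_two

/-- The partial sums of independent centred Gaussian variables with variances `v`, scaled by `d`,
plus independent Gaussian variables with standard deviations `s`. -/
def scaledWalk {p : ℕ} (d s : Fin p → ℝ) (q : (Fin p → ℝ) × (Fin p → ℝ)) (j : Fin p) : ℝ :=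
  d j * ∑ k ∈ Finset.Iic j, q.1 k + s j * q.2 j

/-- The measure under which `scaledWalk` is considered. -/
noncomputable def walkMeasure {p : ℕ} (v : Fin p → NNReal) :
    Measure ((Fin p → ℝ) × (Fin p → ℝ)) :=
  (Measure.pi fun i => gaussianReal 0 (v i)).prod (Measure.pi fun _ => gaussianReal 0 1)

lemma hasGaussianLaw_id_walkMeasure {p : ℕ} (v : Fin p → NNReal) :
    HasGaussianLaw (fun q : (Fin p → ℝ) × (Fin p → ℝ) => (q.1, q.2)) (walkMeasure v) := by
  have h1 := hasGaussianLaw_id_pi_gaussianReal v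
  have h2 := hasGaussianLaw_id_pi_gaussianReal fun _ : Fin p => (1 : NNReal)
  have g1 := h1.isGaussian_map
  have g2 := h2.isGaussian_map
  refine IndepFun.hasGaussianLaw ⟨?_⟩ ⟨?_⟩ (indepFun_prod₀ (X := fun ξ => ξ) (Y := fun η => η)
    h1.aemeasurable h2.aemeasurable)
  · rw [walkMeasure, measurePreserving_fst.map_eq]
    simpa using g1
  · rw [walkMeasure, measurePreserving_snd.map_eq]
    simpa using g2

lemma hasGaussianLaw_scaledWalk {p : ℕ} (v : Fin p → NNReal) (d s : Fin p → ℝ) :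
    HasGaussianLaw (scaledWalk d s) (walkMeasure v) := by
  let L : (Fin p → ℝ) × (Fin p → ℝ) →L[ℝ] Fin p → ℝ := ContinuousLinearMap.pi fun j =>
    d j • (∑ k ∈ Finset.Iic j, (ContinuousLinearMap.proj k : (Fin p → ℝ) →L[ℝ] ℝ) ∘L
      ContinuousLinearMap.fst ℝ _ _) +
    s j • (ContinuousLinearMap.proj j : (Fin p → ℝ) →L[ℝ] ℝ) ∘L ContinuousLinearMap.snd ℝ _ _
  have hL : (fun q : (Fin p → ℝ) × (Fin p → ℝ) => L (q.1, q.2)) = scaledWalk d s := by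
    ext q j
    simp [L, scaledWalk]
  exact hL ▸ (hasGaussianLaw_id_walkMeasure v).map_fun L

lemma integral_scaledWalk {p : ℕ} (v : Fin p → NNReal) (d s : Fin p → ℝ) (j : Fin p) :
    ∫ q, scaledWalk d s q j ∂walkMeasure v = 0 := by
  have hG := hasGaussianLaw_id_walkMeasure v
  have h1 : ∀ k, ∫ q, q.1 k ∂walkMeasure v = 0 := fun k => by
    rw [walkMeasure, integral_fun_fst (fun ξ : Fin p → ℝ => ξ k), integral_eval_pi_gaussianReal,
      smul_zero]
  have h2 : ∫ q, q.2 j ∂walkMeasure v = 0 := by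
    rw [walkMeasure, integral_fun_snd (fun ξ : Fin p → ℝ => ξ j),
      integral_eval_pi_gaussianReal fun _ => 1, smul_zero]
  simp only [scaledWalk]
  rw [integral_add, integral_const_mul, integral_const_mul, integral_finsetSum, h2]
  · simp [h1]
  · exact fun k _ => (hG.fst.eval k).integrable
  · exact (integrable_finsetSum _ fun k _ => (hG.fst.eval k).integrable).const_mul _
  · exact (hG.snd.eval j).integrable.const_mul _

/-- Two partial sums share exactly the increments up to the smaller index, and distinct increments
are uncorrelated; the noise contributes only on the diagonal. -/
lemma covariance_scaledWalk {p : ℕ} (v : Fin p → NNReal) (d s : Fin p → ℝ) (i j : Fin p) :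
    cov[fun q => scaledWalk d s q i, fun q => scaledWalk d s q j; walkMeasure v] =
      d i * d j * ∑ k ∈ Finset.Iic (min i j), (v k : ℝ) + if i = j then s i ^ 2 else 0 := by
  have hG := hasGaussianLaw_id_walkMeasure v
  have := hG.isProbabilityMeasure
  have m1 := fun k => (hG.fst.eval k).memLp_two
  have m2 := fun k => (hG.snd.eval k).memLp_two
  have hA := (hasGaussianLaw_id_pi_gaussianReal v).eval
  have hB := (hasGaussianLaw_id_pi_gaussianReal fun _ : Fin p => (1 : NNReal)).eval
  have c1 : ∀ k l, cov[fun q => q.1 k, fun q => q.1 l; walkMeasure v] =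
      if k = l then (v k : ℝ) else 0 := fun k l => by
    rw [← covariance_eval_pi_gaussianReal]
    exact covariance_comp_fst (hA k).aemeasurable.aestronglyMeasurable
      (hA l).aemeasurable.aestronglyMeasurable
  have c2 : ∀ k l, cov[fun q => q.2 k, fun q => q.2 l; walkMeasure v] =
      if k = l then 1 else 0 := fun k l => by
    have h := covariance_eval_pi_gaussianReal (fun _ : Fin p => (1 : NNReal)) k l
    rw [NNReal.coe_one] at h
    rw [← h]
    exact covariance_comp_snd (hB k).aemeasurable.aestronglyMeasurable
      (hB l).aemeasurable.aestronglyMeasurable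
  have c3 : ∀ k l, cov[fun q => q.1 k, fun q => q.2 l; walkMeasure v] = 0 := fun k l =>
    covariance_fst_snd_prod (hA k).memLp_two (hB l).memLp_two
  have mS : ∀ j : Fin p, MemLp (fun q : (Fin p → ℝ) × (Fin p → ℝ) => ∑ k ∈ Finset.Iic j, q.1 k) 2
      (walkMeasure v) := fun j => memLp_finsetSum _ fun k _ => m1 k
  have cS : ∀ l, cov[fun q => ∑ k ∈ Finset.Iic i, q.1 k, fun q => q.2 l; walkMeasure v] = 0 :=
    fun l => by
      rw [covariance_fun_sum_left' (fun k _ => m1 k) (m2 l)]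
      simp [c3]
  have cS' : ∀ l, cov[fun q => q.2 l, fun q => ∑ k ∈ Finset.Iic j, q.1 k; walkMeasure v] = 0 :=
    fun l => by
      rw [covariance_comm, covariance_fun_sum_left' (fun k _ => m1 k) (m2 l)]
      simp [c3]
  have e : ∀ i, (fun q => scaledWalk d s q i) =
      (fun q : (Fin p → ℝ) × (Fin p → ℝ) => d i * ∑ k ∈ Finset.Iic i, q.1 k) +
        fun q => s i * q.2 i := fun i => rfl
  rw [e, e, covariance_add_left ((mS i).const_mul _) ((m2 i).const_mul _)
      (((mS j).const_mul _).add ((m2 j).const_mul _)),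
    covariance_add_right ((mS i).const_mul _) ((mS j).const_mul _) ((m2 j).const_mul _),
    covariance_add_right ((m2 i).const_mul _) ((mS j).const_mul _) ((m2 j).const_mul _)]
  simp only [covariance_const_mul_left, covariance_const_mul_right, cS, cS', c2]
  rw [covariance_fun_sum_fun_sum' (fun k _ => m1 k) (fun k _ => m1 k)]
  simp only [c1, Finset.sum_ite_eq]
  have hI : Finset.Iic (min i j) = (Finset.Iic i).filter (· ∈ Finset.Iic j) := by
    ext k; simp
  rw [hI, Finset.sum_filter]
  split_ifs with h
  · subst h; ring
  · ring

/-- A lower bound for the probability that a scaled walk stays below the levels `a`. -/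
lemma le_measureReal_scaledWalk {p : ℕ} (v : Fin p → NNReal) {d s a : Fin p → ℝ}
    (hd : ∀ j, 0 < d j) (hs : ∀ j, 0 < s j) {δ x : ℝ} (hx0 : 0 ≤ δ * x)
    (hδ : 0 ≤ δ) (hx : ∀ j, x * d j ≤ a j) (hv : ∑ i, v i ≠ 0) :
    (∫ t in (-(δ * x / √(∑ i, v i : NNReal)))..(δ * x / √(∑ i, v i : NNReal)),
      Real.exp (-t ^ 2 / 2) / √(2 * Real.pi)) * ∏ j, stdNormalCDF ((1 - δ) * a j / s j) ≤
      (walkMeasure v).real {q | ∀ j, scaledWalk d s q j ≤ a j} := by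
  have hbox : ∏ j, stdNormalCDF ((1 - δ) * a j / s j) =
      (Measure.pi fun _ : Fin p => gaussianReal 0 1).real
        (Set.univ.pi fun j => Set.Iic ((1 - δ) * a j / s j)) := by
    rw [measureReal_def, Measure.pi_pi, ENNReal.toReal_prod]
    exact Finset.prod_congr rfl fun j _ => cdf_eq_real _ _
  have hB : ∫ t in (-(δ * x / √(∑ i, v i : NNReal)))..(δ * x / √(∑ i, v i : NNReal)),
      Real.exp (-t ^ 2 / 2) / √(2 * Real.pi) ≤
      (Measure.pi fun i => gaussianReal 0 (v i)).real
        {ξ | ∀ j, ∑ k ∈ Finset.Iic j, ξ k ≤ δ * x} := by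
    rw [integral_exp_neg_sq_div_two_eq _ hv hx0]
    exact two_mul_gaussianReal_Iic_sub_one_le_partialSums v (δ * x)
  rw [hbox]
  refine (mul_le_mul_of_nonneg_right hB measureReal_nonneg).trans ?_
  rw [← measureReal_prod_prod]
  refine measureReal_mono (fun q hq => ?_) (by
    have := (hasGaussianLaw_id_walkMeasure v).isProbabilityMeasure
    exact measure_ne_top _ _)
  -- On the product event, `d j * S j ≤ δ * x * d j ≤ δ * a j` and `s j * η j ≤ (1 - δ) * a j`; the
  -- two shares add up to `a j`, even when `δ > 1`.
  intro j
  have h1 := hq.1 j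
  have h2 : q.2 j ≤ (1 - δ) * a j / s j := hq.2 j trivial
  rw [le_div_iff₀ (hs j)] at h2
  have h3 := mul_le_mul_of_nonneg_left h1 (hd j).le
  have h4 := mul_le_mul_of_nonneg_left (hx j) hδ
  rw [scaledWalk]
  linarith

/-- The increments of a sequence, as nonnegative reals. -/
noncomputable def increment {p : ℕ} (T : ℕ → ℝ) (k : Fin p) : NNReal := (T (k + 1) - T k).toNNReal

lemma sum_Iic_increment {p : ℕ} {T : ℕ → ℝ} (hT0 : T 0 = 0) (hT : ∀ k < p, T k ≤ T (k + 1))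
    (j : Fin p) : ∑ k ∈ Finset.Iic j, (increment T k : ℝ) = T (j + 1) := by
  have h1 : ∀ k : Fin p, (increment T k : ℝ) = T (k + 1) - T k := fun k =>
    Real.coe_toNNReal _ (sub_nonneg.2 (hT k k.2))
  have h2 : (Finset.Iic j).map Fin.valEmbedding = Finset.range (j + 1) := by
    rw [Fin.map_valEmbedding_Iic]; ext k; simp
  have h3 := Finset.sum_map (Finset.Iic j) Fin.valEmbedding (fun k => T (k + 1) - T k)
  rw [h2, Finset.sum_range_sub, hT0, sub_zero] at h3
  rw [h3]
  exact Finset.sum_congr rfl fun k _ => h1 k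

/-! ### Assembling the bound. -/

theorem proposition2 {Ω : Type*} [MeasurableSpace Ω] (μ : Measure Ω) [IsProbabilityMeasure μ]
    -- the normal random variables `Z(t_1), …, Z(t_n)`, with correlations `r`
    (n : ℕ) (Z : ℕ → Ω → ℝ) (r : ℕ → ℕ → ℝ) (hZ : IsStdGaussianFamily μ n Z r)
    (hr : ∀ i ∈ Finset.Icc 1 n, ∀ j ∈ Finset.Icc 1 n, i ≠ j → |r i j| < 1)
    (m : ℕ) (hm : 2 ≤ m) (hmn : m ≤ n)
    -- the normal random variables `V_1, …, V_{m-1}` in the definition of `P(m,h)`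
    {Ω' : Type*} [MeasurableSpace Ω'] (ν : Measure Ω') [IsProbabilityMeasure ν]
    (V : ℕ → Ω' → ℝ) (hV : IsStdGaussianFamily ν (m - 1) V (residualCorr r m))
    (u h : ℝ) (hu : 0 ≤ u)
    (hh : ∀ j ∈ Finset.Icc 1 (m - 1), 0 ≤ upperBound r u h m j)
    (c d : ℕ → ℝ)
    (hc : ∀ j ∈ Finset.Icc 1 (m - 1), 0 < c j) (hd : ∀ j ∈ Finset.Icc 1 (m - 1), 0 < d j)
    (hmono : ∀ j ∈ Finset.Icc 1 (m - 1), ∀ k ∈ Finset.Icc 1 (m - 1), j ≤ k →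
      c j / d j ≤ c k / d k)
    (hlower : ∀ j ∈ Finset.Icc 1 (m - 1), ∀ k ∈ Finset.Icc 1 (m - 1),
      c (min j k) * d (max j k) < r j k - r j m * r k m)
    (δ : ℝ) (hδ : 0 ≤ δ) :
    (∫ t in (-boundB r c d u h m hm δ)..(boundB r c d u h m hm δ),
        Real.exp (-t ^ 2 / 2) / √(2 * Real.pi)) *
      ∏ j ∈ Finset.Icc 1 (m - 1),
        stdNormalCDF ((1 - δ) * (u - r j m * (u + h)) / √(1 - r j m ^ 2 - c j * d j)) ≤
    jointProb ν V r u m h := by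
  -- The indices `1, …, m - 1` become `Fin (p + 1)` shifted by one.
  obtain ⟨p, rfl⟩ : ∃ p, m = p + 2 := ⟨m - 2, by omega⟩
  set M := p + 2 with hM
  have hM1 : M - 1 = p + 1 := by omega
  have hmem : ∀ j : Fin (p + 1), (j : ℕ) + 1 ∈ Finset.Icc 1 (M - 1) := fun j => by
    rw [Finset.mem_Icc]; omega
  have hreind : ∀ j ∈ Finset.Icc 1 (M - 1), ∃ i : Fin (p + 1), (i : ℕ) + 1 = j := fun j hj => by
    rw [Finset.mem_Icc] at hj
    exact ⟨⟨j - 1, by omega⟩, by simp; omega⟩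
  set σ : ℕ → ℝ := fun j => √(1 - r j M ^ 2) with hσ
  have hr1 : ∀ j : Fin (p + 1), 0 < 1 - r (j + 1) M ^ 2 := fun j => by
    have h1 := hr (j + 1) (by rw [Finset.mem_Icc]; omega) M (by rw [Finset.mem_Icc]; omega)
      (by omega)
    have := (sq_lt_one_iff_abs_lt_one _).2 h1
    linarith
  have hrr : ∀ j : Fin (p + 1), r (j + 1) (j + 1) = 1 := fun j => by
    have hj : (j : ℕ) + 1 ∈ Finset.Icc 1 n := by rw [Finset.mem_Icc]; omega
    rw [← hZ.correlation _ hj _ hj, ← hZ.variance_one _ hj]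
    simp only [sq]
  have hσpos : ∀ j : Fin (p + 1), 0 < σ (j + 1) := fun j => Real.sqrt_pos.2 (hr1 j)
  -- The case `j = k` of (ii) leaves a positive variance for the noise.
  have hspos : ∀ j : Fin (p + 1), 0 < 1 - r (j + 1) M ^ 2 - c (j + 1) * d (j + 1) := fun j => by
    have h1 := hlower _ (hmem j) _ (hmem j)
    rw [min_self, max_self, hrr] at h1
    linarith
  set a : ℕ → ℝ := fun j => u - r j M * (u + h) with ha
  have ha0 : ∀ j : Fin (p + 1), 0 ≤ a (j + 1) := fun j => by
    have h1 := hh _ (hmem j)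
    rw [upperBound, le_div_iff₀ (hσpos j), zero_mul] at h1
    exact h1
  set x := (Finset.Icc 1 (M - 1)).inf' (Finset.nonempty_Icc.2 (by omega)) (fun j => a j / d j)
    with hx
  have hxle : ∀ j : Fin (p + 1), x * d (j + 1) ≤ a (j + 1) := fun j => by
    rw [← le_div_iff₀ (hd _ (hmem j))]
    exact Finset.inf'_le (fun j => a j / d j) (hmem j)
  have hx0 : 0 ≤ x := by
    refine Finset.le_inf' _ _ fun j hj => ?_
    obtain ⟨i, rfl⟩ := hreind j hj
    exact div_nonneg (ha0 i) (hd _ hj).le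
  -- Walk times; the value `0` at index `0` makes the first increment `c 1 / d 1`.
  set T : ℕ → ℝ := fun k => if k = 0 then 0 else c k / d k with hT
  have hT0 : T 0 = 0 := if_pos rfl
  have hTs : ∀ k, T (k + 1) = c (k + 1) / d (k + 1) := fun k => if_neg (Nat.succ_ne_zero k)
  have hTpos : ∀ k : Fin (p + 1), 0 < T (k + 1) := fun k => by
    rw [hTs]; exact div_pos (hc _ (hmem k)) (hd _ (hmem k))
  have hTmono : ∀ k < p + 1, T k ≤ T (k + 1) := fun k hk => by
    rcases k with _ | k
    · rw [hT0]; exact (hTpos ⟨0, hk⟩).le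
    · rw [hTs, hTs]
      exact hmono _ (hmem ⟨k, by omega⟩) _ (hmem ⟨k + 1, hk⟩) (Nat.le_succ _)
  set v : Fin (p + 1) → NNReal := increment T with hv
  have hvsum : ∀ j : Fin (p + 1), ∑ k ∈ Finset.Iic j, (v k : ℝ) = T (j + 1) :=
    sum_Iic_increment hT0 hTmono
  have hvtot : ((∑ k, v k : NNReal) : ℝ) = c (M - 1) / d (M - 1) := by
    have h1 := hvsum (Fin.last p)
    have h2 : Finset.Iic (Fin.last p) = Finset.univ := by ext k; simp [Fin.le_last]
    rw [h2, hTs] at h1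
    rw [NNReal.coe_sum, h1, hM1, Fin.val_last]
  have hvne : ∑ k, v k ≠ 0 := fun h0 => by
    rw [h0, NNReal.coe_zero] at hvtot
    have hmax : M - 1 ∈ Finset.Icc 1 (M - 1) := by rw [Finset.mem_Icc]; omega
    exact (div_pos (hc _ hmax) (hd _ hmax)).ne hvtot
  set D : Fin (p + 1) → ℝ := fun j => d (j + 1) with hD
  set s : Fin (p + 1) → ℝ := fun j => √(1 - r (j + 1) M ^ 2 - c (j + 1) * d (j + 1)) with hs
  have hwalk := le_measureReal_scaledWalk v (d := D) (s := s) (a := fun j => a (j + 1)) (δ := δ)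
    (x := x) (fun j => hd _ (hmem j)) (fun j => Real.sqrt_pos.2 (hspos j)) (mul_nonneg hδ hx0) hδ
    hxle hvne
  -- The last partial sum has variance `c_{m-1} / d_{m-1}`, so standardising the level `δ * x`
  -- produces the factor `√(d_{m-1} / c_{m-1})` of `B(δ)`.
  have hBeq : δ * x / √((∑ k, v k : NNReal) : ℝ) = boundB r c d u h M hm δ := by
    rw [boundB, hvtot, ← inv_div (c (M - 1)), Real.sqrt_inv]
    ring
  have hprod : ∏ j ∈ Finset.Icc 1 (M - 1),
      stdNormalCDF ((1 - δ) * (u - r j M * (u + h)) / √(1 - r j M ^ 2 - c j * d j)) =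
      ∏ j : Fin (p + 1), stdNormalCDF ((1 - δ) * a (j + 1) / s j) := by
    rw [Finset.prod_fin_eq_prod_range, hM1, ← Finset.Ico_add_one_right_eq_Icc,
      Finset.prod_Ico_eq_prod_range]
    refine Finset.prod_congr rfl fun j hj => ?_
    rw [dif_pos (Finset.mem_range.1 hj)]
    simp only [hs, ha, add_comm 1 j]
  rw [hBeq] at hwalk
  rw [hprod]
  refine hwalk.trans ?_
  set X : Ω' → Fin (p + 1) → ℝ := fun ω j => σ (j + 1) * V (j + 1) ω with hX
  have hXG : HasGaussianLaw X ν := by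
    let L : (Finset.Icc 1 (M - 1) → ℝ) →L[ℝ] Fin (p + 1) → ℝ := ContinuousLinearMap.pi fun j =>
      σ (j + 1) • ContinuousLinearMap.proj (⟨j + 1, hmem j⟩ : Finset.Icc 1 (M - 1))
    exact hV.gaussian.map_fun L
  have hVG : ∀ j : Fin (p + 1), HasGaussianLaw (V (j + 1)) ν := fun j =>
    hV.gaussian.eval (X := fun (i : Finset.Icc 1 (M - 1)) ω => V i ω) ⟨j + 1, hmem j⟩
  have hXcov : ∀ i j : Fin (p + 1), cov[fun ω => X ω i, fun ω => X ω j; ν] =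
      r (i + 1) (j + 1) - r (i + 1) M * r (j + 1) M := fun i j => by
    simp only [hX]
    rw [covariance_const_mul_left, covariance_const_mul_right,
      covariance_eq_sub (hVG i).memLp_two (hVG j).memLp_two]
    have h1 := hV.correlation _ (hmem i) _ (hmem j)
    rw [hV.mean_zero _ (hmem i), zero_mul, sub_zero]
    simp only [Pi.mul_apply]
    rw [h1, residualCorr, Real.sqrt_mul (hr1 i).le]
    have h2 := (hσpos i).ne'
    have h3 := (hσpos j).ne'
    simp only [hσ] at h2 h3 ⊢
    field_simp
  -- By monotonicity of the times, the shared variance is `c_{min} / d_{min}`; multiplying by `d i *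
  -- d j` leaves `c_{min} d_{max}`.
  have hYcov : ∀ i j : Fin (p + 1),
      cov[fun q => scaledWalk D s q i, fun q => scaledWalk D s q j; walkMeasure v] =
      c (min (i : ℕ) j + 1) * d (max (i : ℕ) j + 1) + if i = j then s i ^ 2 else 0 := fun i j => by
    rw [covariance_scaledWalk, hvsum, hTs]
    congr 1
    have hdi := (hd _ (hmem i)).ne'
    have hdj := (hd _ (hmem j)).ne'
    simp only [hD]
    rcases le_total i j with hij | hij
    · have hij' : (i : ℕ) ≤ j := hij
      rw [min_eq_left hij, min_eq_left hij', max_eq_right hij']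
      field_simp
    · have hij' : (j : ℕ) ≤ i := hij
      rw [min_eq_right hij, min_eq_right hij', max_eq_left hij']
      field_simp
  have hset : {ω | ∀ j ∈ Finset.Icc 1 (M - 1), V j ω ≤ upperBound r u h M j} =
      {ω | ∀ j, X ω j ≤ a (j + 1)} := by
    ext ω
    have key : ∀ j : Fin (p + 1),
        V (j + 1) ω ≤ upperBound r u h M (j + 1) ↔ X ω j ≤ a (j + 1) := fun j => by
      rw [upperBound, le_div_iff₀ (hσpos j), mul_comm]
    constructor
    · exact fun hω j => (key j).1 (hω _ (hmem j))
    · intro hω j hj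
      obtain ⟨i, rfl⟩ := hreind j hj
      exact (key i).2 (hω i)
  rw [jointProb, hset]
  refine measureReal_forall_le_of_covariance_le hXG (hasGaussianLaw_scaledWalk v D s)
    (fun j => ?_) (integral_scaledWalk v D s) (fun j => ?_) (fun i j hij => ?_) _
  · simp only [hX]
    rw [integral_const_mul, hV.mean_zero _ (hmem j), mul_zero]
  -- The noise variance `1 - r_{j,m}² - c j d j` was chosen to make the variances equal.
  · rw [hXcov, hYcov, hrr, if_pos rfl, min_self, max_self, Real.sq_sqrt (hspos j).le]
    ring
  · rw [hXcov, hYcov, if_neg hij, add_zero, ← min_add_add_right, ← max_add_add_right]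
    exact (hlower _ (hmem i) _ (hmem j)).le
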